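/- **Theorem 2.** Let $f,g:(\mathbb{R}^n,0)\to(\mathbb{R}^p,0)$ be two $C^\infty$ map-germs of rank zero (that is, $df(0)=0$ and $dg(0)=0$). Suppose that the following two conditions are satisfied. (i) There exist a germ of $C^\infty$ diffeomorphism $s:(\mathbb{R}^n,0)\to(\mathbb{R}^n,0)$ and a $C^\infty$ map-germ $M:(\mathbb{R}^n,0)\to(GL(p,\mathbb{R}),M(0))$ such that $f(x)=M(x)\,g(s(x))$. (ii) The $C^\infty$ map-germ $F:(\mathbb{R}^n\times\mathbb{R}^p,(0,0))\to(\mathbb{R}^p,0)$ given by $F(x,\lambda)=f(x)-M(x)\lambda$ is a Lipschitz trivial deformation-germ of $f$. Then $f$ and $g$ are bi-Lipschitz $\mathcal{A}$-equivalent: there are germs of bi-Lipschitz homeomorphisms $\sigma:(\mathbb{R}^n,0)\to(\mathbb{R}^n,0)$ and $\tau:(\mathbb{R}^p,0)\to(\mathbb{R}^p,0)$ such that $f=\tau\circ g\circ\sigma$. *Definitions.* A $C^\infty$ map-germ $\Phi:(\mathbb{R}^n\times\mathbb{R}^k,(0,0))\to(\mathbb{R}^p,0)$ with $\Phi(x,0)=f(x)$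 is a *deformation-germ* of $f$. Let $\pi:\mathbb{R}^n\times\mathbb{R}^k\to\mathbb{R}^k$ and $\pi':\mathbb{R}^p\times\mathbb{R}^k\to\mathbb{R}^k$ be the projections. The deformation-germ $\Phi$ is *Lipschitz trivial* if there exist germs at the origins of $L$-stratifications $\mathcal{S}$ of $\mathbb{R}^n\times\mathbb{R}^k$ and $\mathcal{T}$ of $\mathbb{R}^p\times\mathbb{R}^k$ such that (1) $(\Phi,\pi)$ maps each stratum of $\mathcal{S}$ submersively into a stratum of $\mathcal{T}$; (2) $\pi'$ maps each stratum of $\mathcal{T}$ submersively into $\mathbb{R}^k$; (3) for $1\le i\le k$ there are germs of vector fields $\xi_i+\frac{\partial}{\partial\lambda_i}$ on $\mathbb{R}^n\times\mathbb{R}^k$ and $\eta_i+\frac{\partial}{\partial\lambda_i}$ on $\mathbb{R}^p\times\mathbb{R}^k$ at the origins ($\xi_i$, $\eta_i$ having no component along $\mathbb{R}^k$) that are Lipschitz and tangent to the strata of $\mathcal{S}$, respectively $\mathcal{T}$, and such that $d(\Phi,\pi)\bigl(\xi_i+\frac{\partial}{\partial\lambda_i}\bigr)=\bigl(\eta_i+\frac{\partial}{\partial\lambda_i}\bigr)\circ(\Phi,\pi)$.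 An *$L$-stratification* (Mostowski) of an open set $U\subset\mathbb{R}^N$ is a filtration $U=S^N\supset S^{N-1}\supset\dots\supset S^0\supset S^{-1}=\emptyset$ by relatively closed subsets such that each $\mathring S^j=S^j\setminus S^{j-1}$ is empty or a $C^\infty$ submanifold of pure dimension $j$ (the strata are the connected components of the $\mathring S^j$) and the following holds for some $c>1$. Let $l$ be the least index with $S^l\neq\emptyset$, let $d_j(q)=\mathrm{dist}(q,S^j)$, with $d_j\equiv1$ if $S^j=\emptyset$, and for $q\in\mathring S^j$ let $P_q$ be the orthogonal projection of $\mathbb{R}^N$ onto $T_q\mathring S^j$. A *chain* for $q$ consists of indices $j_1>\dots>j_r=l$ and points $q_{j_i}\in\mathring S^{j_i}$ with $q_{j_1}=q$ such that, for $i\ge2$, $j_i$ is the greatest integer less than $j_{i-1}$ with $d_m(q)\ge 2c^2d_{j_i}(q)$ for all $l\le m<j_i$, and $|q-q_{j_i}|\le c\,d_{j_i}(q)$. It is required that for every compact $K\subset U$ there is $C>0$ such that, for every chain with $q\in K$, $$|(I-P_q)P_{q_{j_2}}\cdots P_{q_{j_k}}|\le \frac{C|q-q_{j_2}|}{d_{j_k-1}(q)}\quad(2\le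 k\le r),$$ and, for every $q'\in\mathring S^{j_1}\cap K$ with $|q-q'|\le\frac1{2c}d_{j_1-1}(q)$, $$|(P_q-P_{q'})P_{q_{j_2}}\cdots P_{q_{j_k}}|\le \frac{C|q-q'|}{d_{j_k-1}(q)}\quad(1\le k\le r).$$ -/

import Mathlib

open Set Filter Topology
open scoped ContDiff

noncomputable section

namespace LipGerm

/-! ## Germs at the origin

A germ at the origin is given by a representative defined on the whole space; only its values near
the origin matter. -/

section Germs

variable {E F : Type*} [NormedAddCommGroup E] [NormedSpace ℝ E]
  [NormedAddCommGroup F] [NormedSpace ℝ F]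

/-- `f` is `C^∞` on a neighbourhood of the origin. -/
def SmoothNearZero (f : E → F) : Prop :=
  ∀ᶠ x in 𝓝 (0 : E), ContDiffAt ℝ ∞ f x

/-- `f : (E, 0) → (F, 0)` is a `C^∞` map-germ. -/
def IsSmoothMapGerm (f : E → F) : Prop :=
  f 0 = 0 ∧ SmoothNearZero f

/-- The differential of `f` at the origin has rank zero. -/
def HasRankZero (f : E → F) : Prop :=
  fderiv ℝ f 0 = 0

/-- `h : (E, 0) → (E, 0)` is a germ of a `C^∞` diffeomorphism. -/
def IsDiffeoGerm (h : E → E) : Prop :=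
  h 0 = 0 ∧ ∃ e : OpenPartialHomeomorph E E, (0 : E) ∈ e.source ∧ (∀ x ∈ e.source, e x = h x) ∧
    ContDiffOn ℝ ∞ e e.source ∧ ContDiffOn ℝ ∞ e.symm e.target

/-- `h : (E, 0) → (E, 0)` is a germ of a bi-Lipschitz homeomorphism. -/
def IsBiLipschitzGerm (h : E → E) : Prop :=
  h 0 = 0 ∧ ∃ e : OpenPartialHomeomorph E E, (0 : E) ∈ e.source ∧ (∀ x ∈ e.source, e x = h x) ∧
    (∃ K, LipschitzOnWith K e e.source) ∧ ∃ K, LipschitzOnWith K e.symm e.target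

/-- Bi-Lipschitz `𝒜`-equivalence of germs: `f = t ∘ g ∘ s` near the origin, with `s` and `t` germs
of bi-Lipschitz homeomorphisms. -/
def BiLipschitzAEquiv (f g : E → F) : Prop :=
  ∃ (s : E → E) (t : F → F), IsBiLipschitzGerm s ∧ IsBiLipschitzGerm t ∧
    ∀ᶠ x in 𝓝 (0 : E), f x = t (g (s x))

end Germs

/-! ## Stratifications -/

section Stratifications

variable {E F : Type*} [NormedAddCommGroup E] [InnerProductSpace ℝ E] [FiniteDimensional ℝ E]
  [NormedAddCommGroup F] [InnerProductSpace ℝ F] [FiniteDimensional ℝ F]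

/-- `X ⊆ E` is an (embedded, not necessarily closed) `C^∞` submanifold of pure dimension `d`:
locally it is straightened to a `d`-dimensional linear subspace by a diffeomorphism. -/
def IsSmoothSubmanifold (X : Set E) (d : ℕ) : Prop :=
  ∀ x ∈ X, ∃ (φ : OpenPartialHomeomorph E E) (W : Submodule ℝ E), x ∈ φ.source ∧
    ContDiffOn ℝ ∞ φ φ.source ∧ ContDiffOn ℝ ∞ φ.symm φ.target ∧
    Module.finrank ℝ W = d ∧ ∀ y ∈ φ.source, (y ∈ X ↔ φ y ∈ W)

/-- The tangent space at `x` of a submanifold `X` of `E`, spanned by the velocities of the curves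
in `X` through `x`. -/
def tangentSpaceAt (X : Set E) (x : E) : Submodule ℝ E :=
  Submodule.span ℝ {v | ∃ γ : ℝ → E, γ 0 = x ∧ (∀ᶠ t in 𝓝 (0 : ℝ), γ t ∈ X) ∧ HasDerivAt γ v 0}

/-- For a filtration `S 0 ⊆ S 1 ⊆ ⋯` this is `S (j - 1)`, read as `∅` for `j = 0`. -/
def below (S : ℕ → Set E) (j : ℕ) : Set E := ⋃ k < j, S k

/-- The `j`-dimensional layer `S j \ S (j - 1)` of a filtration. -/
def layer (S : ℕ → Set E) (j : ℕ) : Set E := S j \ below S j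

/-- `S` is a stratification of the open set `U`, as a filtration `S 0 ⊆ S 1 ⊆ ⋯` of `U` by
relatively closed subsets such that each `S j \ S (j - 1)` is empty or a `C^∞` submanifold of
pure dimension `j`. -/
structure IsStratification (U : Set E) (S : ℕ → Set E) : Prop where
  subset : ∀ j, S j ⊆ U
  mono : Monotone S
  closed : ∀ j, closure (S j) ∩ U ⊆ S j
  top : S (Module.finrank ℝ E) = U
  manifold : ∀ j, IsSmoothSubmanifold (layer S j) j

/-- The strata are the connected components of the layers. -/
def IsStratum (S : ℕ → Set E) (X : Set E) : Prop :=
  ∃ j, ∃ x ∈ layer S j, X = connectedComponentIn (layer S j) x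

/-- The stratification of the whole space with the single stratum `E`. -/
def trivialStratification (E : Type*) [NormedAddCommGroup E] [InnerProductSpace ℝ E] :
    ℕ → Set E :=
  fun j => {_x | Module.finrank ℝ E ≤ j}

/-- Orthogonal projection of `E` onto the tangent space of the submanifold `X` at `x`. -/
def tangentProj (X : Set E) (x : E) : E →L[ℝ] E :=
  (tangentSpaceAt X x).starProjection

open Classical in
/-- Distance to a set, with the convention that the distance to the empty set is `1`. -/
def distTo (A : Set E) (x : E) : ℝ :=
  if A = ∅ then 1 else Metric.infDist x A

/-- A `c`-chain for the point `q 0`: a strictly decreasing sequence of dimensions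
`j 0 > j 1 > ⋯ > j r`, ending with the smallest dimension that occurs, and points
`q s ∈ S (j s) \ S (j s - 1)` such that, for `1 ≤ s ≤ r`, `j s` is the greatest integer smaller
than `j (s - 1)` for which `dist (q 0, S k) ≥ 2 c ^ 2 dist (q 0, S (j s))` for all `k < j s` with
`S k` nonempty, and `|q 0 - q s| ≤ c dist (q 0, S (j s))`.
The values of `j` and `q` beyond `r` are irrelevant. -/
structure IsLipChain (S : ℕ → Set E) (c : ℝ) (r : ℕ) (j : ℕ → ℕ) (q : ℕ → E) : Prop where
  mem : ∀ s ≤ r, q s ∈ layer S (j s)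
  greatest : ∀ s < r, IsGreatest
    {i | i < j s ∧ (S i).Nonempty ∧ ∀ k < i, (S k).Nonempty →
      2 * c ^ 2 * Metric.infDist (q 0) (S i) ≤ Metric.infDist (q 0) (S k)} (j (s + 1))
  near : ∀ s ≤ r, 1 ≤ s → dist (q 0) (q s) ≤ c * Metric.infDist (q 0) (S (j s))
  last : below S (j r) = ∅

/-- The composition `P_{q 1} P_{q 2} ⋯ P_{q m}` of the orthogonal projections onto the tangent
spaces at the points of a chain (the identity for `m = 0`). -/
def chainProj (S : ℕ → Set E) (j : ℕ → ℕ) (q : ℕ → E) : ℕ → (E →L[ℝ] E)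
  | 0 => ContinuousLinearMap.id ℝ E
  | m + 1 => (chainProj S j q m).comp (tangentProj (layer S (j (m + 1))) (q (m + 1)))

/-- `S` is a Lipschitz stratification (`L`-stratification) of the open set `U` in the sense of
Mostowski: the projections along chains satisfy Mostowski's inequalities, with a constant that
is uniform on compact subsets of `U`. The case `m = 0` of the second inequality is the bound
`|P_q - P_q'| ≤ C |q - q'| / dist (q, S (j 0 - 1))`. -/
structure IsLStratification (U : Set E) (S : ℕ → Set E) : Prop where
  strat : IsStratification U S
  lipschitz : ∃ c : ℝ, 1 < c ∧ ∀ K ⊆ U, IsCompact K → ∃ C : ℝ, 0 < C ∧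
    ∀ (r : ℕ) (j : ℕ → ℕ) (q : ℕ → E), IsLipChain S c r j q → q 0 ∈ K →
      (∀ m, 1 ≤ m → m ≤ r →
        ‖(ContinuousLinearMap.id ℝ E - tangentProj (layer S (j 0)) (q 0)).comp
            (chainProj S j q m)‖
          ≤ C * dist (q 0) (q 1) / distTo (below S (j m)) (q 0)) ∧
      (∀ q' ∈ layer S (j 0) ∩ K,
        dist (q 0) q' ≤ 1 / (2 * c) * distTo (below S (j 0)) (q 0) →
        ∀ m ≤ r,
          ‖(tangentProj (layer S (j 0)) (q 0) - tangentProj (layer S (j 0)) q').comp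
              (chainProj S j q m)‖
            ≤ C * dist (q 0) q' / distTo (below S (j m)) (q 0))

/-- `φ` is a stratified map: it sends each stratum of `S` into a stratum of `T`, submersively. -/
def IsStratifiedMap (φ : E → F) (S : ℕ → Set E) (T : ℕ → Set F) : Prop :=
  ∀ X, IsStratum S X → ∃ Y, IsStratum T Y ∧ MapsTo φ X Y ∧
    ∀ x ∈ X, (tangentSpaceAt X x).map (fderiv ℝ φ x : E →ₗ[ℝ] F) = tangentSpaceAt Y (φ x)

/-- `v` is a germ at the origin of a stratified Lipschitz vector field: it is Lipschitz near the
origin and tangent to the strata of `S`. -/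
def IsStratifiedLipschitzField (S : ℕ → Set E) (v : E → E) : Prop :=
  (∃ N ∈ 𝓝 (0 : E), ∃ K, LipschitzOnWith K v N) ∧
    ∀ᶠ x in 𝓝 (0 : E), ∀ X, IsStratum S X → x ∈ X → v x ∈ tangentSpaceAt X x

end Stratifications

/-! ## Deformations -/

/-- `ℝⁿ` with its Euclidean norm. -/
abbrev R (n : ℕ) : Type := EuclideanSpace ℝ (Fin n)

/-- `ℝⁿ × ℝᵏ` with its Euclidean norm. -/
abbrev RR (n k : ℕ) : Type := WithLp 2 (R n × R k)

/-- The point `(x, l)` of `ℝⁿ × ℝᵏ`. -/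
abbrev pt {n k : ℕ} (x : R n) (l : R k) : RR n k := WithLp.toLp 2 (x, l)

/-- The map `(Φ, π) : ℝⁿ × ℝᵏ → ℝᵖ × ℝᵏ`, `π` being the projection to `ℝᵏ`. -/
def withParam {n p k : ℕ} (Φ : RR n k → R p) : RR n k → RR p k :=
  fun z => pt (Φ z) z.snd

/-- The vector field `ξ + ∂/∂λ_i` on `ℝⁿ × ℝᵏ`. -/
def addParamField {n k : ℕ} (ξ : RR n k → R n) (i : Fin k) : RR n k → RR n k :=
  fun z => pt (ξ z) (EuclideanSpace.single i (1 : ℝ))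

/-- `Φ` is a `C^∞` deformation-germ of `f`. -/
def IsDeformation {n p k : ℕ} (f : R n → R p) (Φ : RR n k → R p) : Prop :=
  IsSmoothMapGerm Φ ∧ ∀ᶠ x in 𝓝 (0 : R n), Φ (pt x 0) = f x

/-- `Φ` is a Lipschitz trivial deformation-germ of `f`. Germs of stratifications are represented
by stratifications of open neighbourhoods `U`, `V` of the origins. -/
def IsLipschitzTrivialDeformation {n p k : ℕ} (f : R n → R p) (Φ : RR n k → R p) : Prop :=
  IsDeformation f Φ ∧
  ∃ (U : Set (RR n k)) (V : Set (RR p k)) (S : ℕ → Set (RR n k)) (T : ℕ → Set (RR p k)),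
    IsOpen U ∧ (0 : RR n k) ∈ U ∧ IsOpen V ∧ (0 : RR p k) ∈ V ∧
    ContDiffOn ℝ ∞ Φ U ∧
    IsLStratification U S ∧ IsLStratification V T ∧
    IsStratifiedMap (withParam Φ) S T ∧
    IsStratifiedMap (fun z : RR p k => z.snd) T (trivialStratification (R k)) ∧
    ∃ (ξ : Fin k → RR n k → R n) (η : Fin k → RR p k → R p), ∀ i,
      IsStratifiedLipschitzField S (addParamField (ξ i) i) ∧
      IsStratifiedLipschitzField T (addParamField (η i) i) ∧
      ∀ᶠ z in 𝓝 (0 : RR n k),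
        fderiv ℝ (withParam Φ) z (addParamField (ξ i) i z) =
          addParamField (η i) i (withParam Φ z)

/-- The action of an invertible matrix on a vector of `ℝᵖ`. -/
def act {p : ℕ} (A : Matrix.GeneralLinearGroup (Fin p) ℝ) (y : R p) : R p :=
  WithLp.toLp 2 (A.val.mulVec y.ofLp)

end LipGerm

end

namespace LipGerm

/-! ### Flow of a Lipschitz field along parameter segments -/

section Flow

open scoped NNReal

/-! Write `F(x, λ) = f(x) - M(x)λ`. Hypothesis (i) says that `F(x, g(s(x))) = 0`. Flow along the
trivialising fields over the segment of parameters from `λ = g(s(x))` to `0`. In the source this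
carries `x` to `ρ(x)`; in the target it carries `0` to `θ(g(s(x)))`. The source field lifts the
target field over `F`, so by uniqueness of integral curves `F(ρ(x), 0) = θ(g(s(x)))`, that is, `f ∘
ρ = θ ∘ g ∘ s`.

It remains to see that `ρ` and `θ` are bi-Lipschitz. Although the fields are only Lipschitz, the
time-one map is strictly differentiable at the origin, with derivative `(x, l) ↦ x - v 0 l`
(`hasStrictFDerivAt_of_isRadialCurve`): the velocity is linear in `l`, so the error terms carry a
small factor. Since `g` has rank zero, `dρ(0)` is the identity. Since `f` has rank zero, the lifting
equation at the origin forces `η_i(0) = -M(0)e_i`, so `dθ(0) = M(0)`. Both are invertible, and the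
inverse function theorem for strict derivatives gives bi-Lipschitz germs
(`isBiLipschitzGerm_of_hasStrictFDerivAt`). Hence `f = θ ∘ g ∘ (s ∘ ρ⁻¹)`. -/

theorem eventually_mul_norm_snd_lt {E P : Type*} [NormedAddCommGroup E] [NormedAddCommGroup P]
    (K : ℝ≥0) : ∀ᶠ z in 𝓝 (0 : E × P), K * ‖z.2‖ < 1 / 2 :=
  ((continuous_const.mul continuous_snd.norm).tendsto (0 : E × P)).eventually_lt_const (by simp)

variable {E P : Type*} [NormedAddCommGroup E] [NormedSpace ℝ E]
  [NormedAddCommGroup P] [NormedSpace ℝ P]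

/-- `X` is an integral curve on `[0, 1]` of the parametrised field `v`, along the segment of
parameters from `l` to `0`. -/
def IsRadialCurve (v : E × P → P →L[ℝ] E) (l : P) (X : ℝ → E) : Prop :=
  ∀ t ∈ Icc (0 : ℝ) 1, HasDerivWithinAt X (-(v (X t, (1 - t) • l) l)) (Icc 0 1) t

theorem norm_smul_one_sub_le {t : ℝ} (ht : t ∈ Icc (0 : ℝ) 1) (l : P) : ‖(1 - t) • l‖ ≤ ‖l‖ := by
  rw [norm_smul, Real.norm_eq_abs, abs_of_nonneg (by linarith [ht.2])]
  exact mul_le_of_le_one_left (norm_nonneg _) (by linarith [ht.1])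

theorem norm_field_sub_le {v : E × P → P →L[ℝ] E} {K : ℝ≥0} (hv : LipschitzWith K v)
    (x x' : E) (l l' : P) {t : ℝ} (ht : t ∈ Icc (0 : ℝ) 1) :
    ‖v (x, (1 - t) • l) - v (x', (1 - t) • l')‖ ≤ K * (‖x - x'‖ + ‖l - l'‖) := by
  refine (hv.norm_sub_le _ _).trans ?_
  gcongr
  rw [Prod.mk_sub_mk, ← smul_sub, Prod.norm_mk]
  have := norm_smul_one_sub_le ht (l - l')
  refine max_le ?_ ?_ <;> linarith [norm_nonneg (x - x'), norm_nonneg (l - l')]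

theorem norm_field_sub_zero_le {v : E × P → P →L[ℝ] E} {K : ℝ≥0} (hv : LipschitzWith K v)
    (x : E) (l : P) {t : ℝ} (ht : t ∈ Icc (0 : ℝ) 1) :
    ‖v (x, (1 - t) • l) - v 0‖ ≤ K * (‖x‖ + ‖l‖) := by
  simpa [← Prod.zero_eq_mk] using norm_field_sub_le hv x 0 l 0 ht

theorem norm_field_le {v : E × P → P →L[ℝ] E} {K : ℝ≥0} (hv : LipschitzWith K v)
    (x : E) (l : P) {t : ℝ} (ht : t ∈ Icc (0 : ℝ) 1) :
    ‖v (x, (1 - t) • l)‖ ≤ ‖v 0‖ + K * (‖x‖ + ‖l‖) :=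
  (norm_le_norm_add_norm_sub' _ _).trans
    (add_le_add_right (norm_field_sub_zero_le hv x l ht) _)

/-- An elementary substitute for Grönwall: let `D` be the maximal gap on `[0, 1]`. The mean value
inequality bounds `D` by the initial gap, a multiple of `‖l - l'‖` and `K * ‖l‖ * D ≤ D / 2`; the
last term is absorbed on the left. Only the field along the second curve needs a bound `B`. -/
theorem IsRadialCurve.norm_sub_le {v : E × P → P →L[ℝ] E} {K : ℝ≥0} (hv : LipschitzWith K v)
    {l l' : P} {X X' : ℝ → E} (hX : IsRadialCurve v l X) (hX' : IsRadialCurve v l' X')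
    (hl : K * ‖l‖ ≤ 1 / 2) {B : ℝ} (hB : ∀ t ∈ Icc (0 : ℝ) 1, ‖v (X' t, (1 - t) • l')‖ ≤ B)
    {t : ℝ} (ht : t ∈ Icc (0 : ℝ) 1) :
    ‖X t - X' t‖ ≤ 2 * (‖X 0 - X' 0‖ + (B + 1) * ‖l - l'‖) := by
  have hd : ∀ t ∈ Icc (0 : ℝ) 1, HasDerivWithinAt (fun t => X t - X' t)
      (-(v (X t, (1 - t) • l) l) - -(v (X' t, (1 - t) • l') l')) (Icc 0 1) t :=
    fun t ht => (hX t ht).sub (hX' t ht)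
  have hc : ContinuousOn (fun t => ‖X t - X' t‖) (Icc 0 1) :=
    ContinuousOn.norm fun t ht => (hd t ht).continuousWithinAt
  obtain ⟨m, hm, hmax⟩ := isCompact_Icc.exists_isMaxOn (nonempty_Icc.2 zero_le_one) hc
  set D := ‖X m - X' m‖ with hD
  have hB0 : 0 ≤ B := (norm_nonneg _).trans (hB 0 ⟨le_rfl, zero_le_one⟩)
  have hle : ∀ t ∈ Icc (0 : ℝ) 1, ‖X t - X' t‖ ≤ D := fun t ht => hmax ht
  have hb : ∀ t ∈ Icc (0 : ℝ) 1,
      ‖-(v (X t, (1 - t) • l) l) - -(v (X' t, (1 - t) • l') l')‖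
        ≤ 1 / 2 * D + (B + 1 / 2) * ‖l - l'‖ := by
    intro t ht
    have e : -(v (X t, (1 - t) • l) l) - -(v (X' t, (1 - t) • l') l')
        = -((v (X t, (1 - t) • l) - v (X' t, (1 - t) • l')) l
          + v (X' t, (1 - t) • l') (l - l')) := by
      simp only [sub_apply, map_sub]; abel
    rw [e, norm_neg]
    refine (norm_add_le _ _).trans ?_
    have h1 := ((v (X t, (1 - t) • l) - v (X' t, (1 - t) • l')).le_opNorm l).trans
      (mul_le_mul_of_nonneg_right (norm_field_sub_le hv (X t) (X' t) l l' ht) (norm_nonneg l))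
    have h2 := ((v (X' t, (1 - t) • l')).le_opNorm (l - l')).trans
      (mul_le_mul_of_nonneg_right (hB t ht) (norm_nonneg _))
    have h3 : K * (‖X t - X' t‖ + ‖l - l'‖) * ‖l‖ ≤ 1 / 2 * (D + ‖l - l'‖) := by
      calc K * (‖X t - X' t‖ + ‖l - l'‖) * ‖l‖
          = K * ‖l‖ * (‖X t - X' t‖ + ‖l - l'‖) := by ring
        _ ≤ 1 / 2 * (D + ‖l - l'‖) := by
          gcongr
          exact hle t ht
    linarith
  have key := norm_image_sub_le_of_norm_deriv_le_segment' hd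
    (fun t ht => hb t (Ico_subset_Icc_self ht)) m hm
  have h1 : D ≤ ‖X 0 - X' 0‖ + ‖(X m - X' m) - (X 0 - X' 0)‖ := by
    have := norm_add_le (X 0 - X' 0) ((X m - X' m) - (X 0 - X' 0))
    rwa [add_sub_cancel] at this
  have hD0 : 0 ≤ D := norm_nonneg _
  have hnn : 0 ≤ 1 / 2 * D + (B + 1 / 2) * ‖l - l'‖ := by positivity
  have h2 : (1 / 2 * D + (B + 1 / 2) * ‖l - l'‖) * (m - 0)
      ≤ 1 / 2 * D + (B + 1 / 2) * ‖l - l'‖ :=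
    mul_le_of_le_one_right hnn (by linarith [hm.2])
  have := hle t ht
  nlinarith [norm_nonneg (l - l')]

/-- Comparison with the constant curve `0`, which is integral for the parameter `0`. -/
theorem IsRadialCurve.norm_le {v : E × P → P →L[ℝ] E} {K : ℝ≥0} (hv : LipschitzWith K v)
    {l : P} {X : ℝ → E} (hX : IsRadialCurve v l X) (hl : K * ‖l‖ ≤ 1 / 2)
    {t : ℝ} (ht : t ∈ Icc (0 : ℝ) 1) :
    ‖X t‖ ≤ 2 * (‖X 0‖ + (‖v 0‖ + 1) * ‖l‖) := by
  have h0 : IsRadialCurve v (0 : P) (fun _ => (0 : E)) := fun t _ => by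
    simpa using hasDerivWithinAt_const t (Icc (0 : ℝ) 1) (0 : E)
  have := hX.norm_sub_le hv h0 hl (B := ‖v 0‖) (fun t _ => by simp [← Prod.zero_eq_mk]) ht
  simpa using this

/-- Curves starting near the origin stay near it up to time one, so identities between germs may be
used along whole curves. -/
theorem eventually_forall_isRadialCurve {v : E × P → P →L[ℝ] E} {K : ℝ≥0}
    (hv : LipschitzWith K v) {Q : E × P → Prop} (hQ : ∀ᶠ z in 𝓝 (0 : E × P), Q z) :
    ∀ᶠ z in 𝓝 (0 : E × P), ∀ X : ℝ → E, X 0 = z.1 → IsRadialCurve v z.2 X →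
      ∀ t ∈ Icc (0 : ℝ) 1, Q (X t, (1 - t) • z.2) := by
  obtain ⟨r, hr, hball⟩ := Metric.eventually_nhds_iff_ball.1 hQ
  have e1 : ∀ᶠ z in 𝓝 (0 : E × P), 2 * (‖z.1‖ + (‖v 0‖ + 1) * ‖z.2‖) < r :=
    (Continuous.tendsto' (by fun_prop) (0 : E × P) 0 (by simp)).eventually_lt_const hr
  have e2 : ∀ᶠ z in 𝓝 (0 : E × P), ‖z.2‖ < r :=
    (Continuous.tendsto' (by fun_prop) (0 : E × P) 0 (by simp)).eventually_lt_const hr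
  filter_upwards [e1, e2, eventually_mul_norm_snd_lt K] with z h1 h2 h3 X hX0 hX t ht
  refine hball _ (mem_ball_zero_iff.2 (max_lt ?_ ?_))
  · have := hX.norm_le hv h3.le ht
    rw [hX0] at this
    exact this.trans_lt h1
  · exact (norm_smul_one_sub_le ht _).trans_lt h2

theorem IsRadialCurve.eq_of_eq_zero {v : E × P → P →L[ℝ] E} {K : ℝ≥0} (hv : LipschitzWith K v)
    {l : P} {X X' : ℝ → E} (hX : IsRadialCurve v l X) (hX' : IsRadialCurve v l X')
    (hl : K * ‖l‖ ≤ 1 / 2) (h0 : X 0 = X' 0) {t : ℝ} (ht : t ∈ Icc (0 : ℝ) 1) : X t = X' t := by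
  have hB : ∀ t ∈ Icc (0 : ℝ) 1, ‖v (X' t, (1 - t) • l)‖
      ≤ ‖v 0‖ + K * (2 * (‖X' 0‖ + (‖v 0‖ + 1) * ‖l‖) + ‖l‖) := by
    intro t ht
    refine (norm_field_le hv (X' t) l ht).trans ?_
    gcongr
    exact hX'.norm_le hv hl ht
  have := hX.norm_sub_le hv hX' hl hB ht
  rw [h0, sub_self, sub_self, norm_zero, norm_zero, mul_zero, add_zero, mul_zero] at this
  exact sub_eq_zero.1 (norm_le_zero_iff.1 this)

theorem exists_isRadialCurve [CompleteSpace E] {v : E × P → P →L[ℝ] E} {K : ℝ≥0}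
    (hv : LipschitzWith K v) :
    ∀ᶠ z in 𝓝 (0 : E × P), ∃ X, X 0 = z.1 ∧ IsRadialCurve v z.2 X := by
  -- `B` bounds the field for `‖y‖ ≤ 1`, `‖l‖ ≤ 1`. With `B * ‖l‖ < 1 / 2`, a curve starting in the
  -- ball of radius `1 / 2` moves at most `1 / 2` in unit time.
  set B : ℝ := ‖v 0‖ + K * 2 with hB
  have hB0 : 0 ≤ B := by positivity
  have e1 : ∀ᶠ z in 𝓝 (0 : E × P), ‖z.1‖ < 1 / 2 :=
    (continuous_fst.norm.tendsto (0 : E × P)).eventually_lt_const (by simp)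
  have e2 : ∀ᶠ z in 𝓝 (0 : E × P), ‖z.2‖ < 1 :=
    (continuous_snd.norm.tendsto (0 : E × P)).eventually_lt_const (by simp)
  have e3 : ∀ᶠ z in 𝓝 (0 : E × P), B * ‖z.2‖ < 1 / 2 :=
    ((continuous_const.mul continuous_snd.norm).tendsto (0 : E × P)).eventually_lt_const (by simp)
  filter_upwards [e1, e2, e3] with ⟨x, l⟩ h1 h2 h3
  simp only at h1 h2 h3 ⊢
  have hp : IsPicardLindelof (fun t y => -(v (y, (1 - t) • l) l))
      (⟨0, ⟨le_rfl, zero_le_one⟩⟩ : Icc (0 : ℝ) 1) x (1 / 2) 0 (1 / 2) (K * ‖l‖₊) := by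
    refine ⟨fun t ht => LipschitzWith.lipschitzOnWith ?_, fun y _ => ?_, fun t ht y hy => ?_, ?_⟩
    · refine LipschitzWith.of_dist_le_mul fun y y' => ?_
      rw [dist_eq_norm, dist_eq_norm, neg_sub_neg, ← sub_apply]
      have := norm_field_sub_le hv y' y l l ht
      rw [sub_self, norm_zero, add_zero] at this
      refine ((v (y', (1 - t) • l) - v (y, (1 - t) • l)).le_opNorm l).trans
        ((mul_le_mul_of_nonneg_right this (norm_nonneg l)).trans_eq ?_)
      rw [norm_sub_rev y' y]
      push_cast
      ring
    · have hvc := hv.continuous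
      exact Continuous.continuousOn (by fun_prop)
    · have hy' : ‖y‖ ≤ 1 := by
        have := norm_le_norm_add_norm_sub' y x
        rw [Metric.mem_closedBall, dist_eq_norm] at hy
        norm_num at hy
        linarith
      have h5 := norm_field_le hv y l ht
      have h6 : (K : ℝ) * (‖y‖ + ‖l‖) ≤ K * 2 := by gcongr; linarith
      rw [norm_neg]
      refine ((v (y, (1 - t) • l)).le_opNorm l).trans ?_
      have : ‖v (y, (1 - t) • l)‖ * ‖l‖ ≤ B * ‖l‖ := by gcongr; linarith
      norm_num
      linarith
    · norm_num
  obtain ⟨X, hX0, hX⟩ := hp.exists_eq_forall_mem_Icc_hasDerivWithinAt₀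
  exact ⟨X, hX0, hX⟩

/-- The time-one map of a Lipschitz parametrised field along segments of parameters is strictly
differentiable at the origin. -/
theorem hasStrictFDerivAt_of_isRadialCurve {v : E × P → P →L[ℝ] E} {K : ℝ≥0}
    (hv : LipschitzWith K v) {X : E × P → ℝ → E}
    (hX : ∀ᶠ z in 𝓝 (0 : E × P), X z 0 = z.1 ∧ IsRadialCurve v z.2 (X z)) :
    HasStrictFDerivAt (fun z => X z 1)
      (ContinuousLinearMap.fst ℝ E P - (v 0).comp (ContinuousLinearMap.snd ℝ E P)) 0 := by
  set A : ℝ := ‖v 0‖ with hA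
  have hA0 : 0 ≤ A := norm_nonneg _
  rw [hasStrictFDerivAt_iff_isLittleO, Asymptotics.isLittleO_iff]
  intro ε hε
  -- The bound `1` controls the field along `Y'` by `A + 1`; the bound `ε / 2` makes that field
  -- close to `v 0`. In `e4`, the factor `2 * (A + 3)` is the Lipschitz constant of the curves in
  -- their initial data.
  have e3 : ∀ᶠ z in 𝓝 (0 : E × P),
      K * (2 * (‖z.1‖ + (A + 1) * ‖z.2‖) + ‖z.2‖) < min 1 (ε / 2) := by
    refine (Continuous.tendsto' (by fun_prop) (0 : E × P) 0 (by simp)).eventually_lt_const ?_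
    positivity
  have e4 : ∀ᶠ z in 𝓝 (0 : E × P), K * (2 * (A + 3) + 1) * ‖z.2‖ < ε / 2 := by
    refine (Continuous.tendsto' (by fun_prop) (0 : E × P) 0 (by simp)).eventually_lt_const ?_
    positivity
  have h := hX.and ((eventually_mul_norm_snd_lt K).and (e3.and e4))
  rw [nhds_prod_eq]
  filter_upwards [h.prod_mk h] with
    ⟨⟨x, l⟩, ⟨x', l'⟩⟩ ⟨⟨⟨hx, hc⟩, h2, _, h4⟩, ⟨⟨hx', hc'⟩, h2', h3', _⟩⟩
  set Y := X (x, l)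
  set Y' := X (x', l')
  simp only at hx hc h2 h4 hx' hc' h2' h3'
  have hY' : ∀ t ∈ Icc (0 : ℝ) 1, K * (‖Y' t‖ + ‖l'‖) < min 1 (ε / 2) := by
    intro t ht
    refine lt_of_le_of_lt ?_ h3'
    gcongr
    rw [← hx']
    exact hc'.norm_le hv h2'.le ht
  have hB : ∀ t ∈ Icc (0 : ℝ) 1, ‖v (Y' t, (1 - t) • l')‖ ≤ A + 1 := fun t ht =>
    (norm_field_le hv _ _ ht).trans (add_le_add_right ((hY' t ht).le.trans (min_le_left _ _)) _)
  set d := ‖((x, l) : E × P) - (x', l')‖ with hd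
  have hdx : ‖x - x'‖ ≤ d := norm_fst_le ((x, l) - (x', l') : E × P)
  have hdl : ‖l - l'‖ ≤ d := norm_snd_le ((x, l) - (x', l') : E × P)
  -- The linear term in `t` is chosen so that the increment over `[0, 1]` is exactly the remainder
  -- in the definition of the strict derivative.
  have hder : ∀ t ∈ Icc (0 : ℝ) 1, HasDerivWithinAt (fun t => Y t - Y' t + t • v 0 (l - l'))
      (-(v (Y t, (1 - t) • l) l) - -(v (Y' t, (1 - t) • l') l') + (1 : ℝ) • v 0 (l - l'))
      (Icc 0 1) t :=
    fun t ht => ((hc t ht).sub (hc' t ht)).add ((hasDerivWithinAt_id t _).smul_const _)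
  have key := norm_image_sub_le_of_norm_deriv_le_segment_01' (C := ε * d) hder ?_
  · have e : Y 1 - Y' 1 - (ContinuousLinearMap.fst ℝ E P -
        (v 0).comp (ContinuousLinearMap.snd ℝ E P)) ((x, l) - (x', l'))
        = Y 1 - Y' 1 + (1 : ℝ) • v 0 (l - l') - (Y 0 - Y' 0 + (0 : ℝ) • v 0 (l - l')) := by
      rw [hx, hx']
      simp only [Prod.mk_sub_mk, sub_apply, ContinuousLinearMap.comp_apply,
        ContinuousLinearMap.coe_fst', ContinuousLinearMap.coe_snd', one_smul, zero_smul, add_zero]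
      abel
    exact (congrArg norm e).trans_le key
  · intro t ht
    replace ht := Ico_subset_Icc_self ht
    have e : -(v (Y t, (1 - t) • l) l) - -(v (Y' t, (1 - t) • l') l') + (1 : ℝ) • v 0 (l - l')
        = -((v (Y t, (1 - t) • l) - v (Y' t, (1 - t) • l')) l
          + (v (Y' t, (1 - t) • l') - v 0) (l - l')) := by
      simp only [sub_apply, map_sub, one_smul]; abel
    rw [e, norm_neg]
    refine (norm_add_le _ _).trans ?_
    have hD : ‖Y t - Y' t‖ ≤ 2 * (A + 3) * d := by
      have := hc.norm_sub_le hv hc' h2.le hB ht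
      rw [hx, hx'] at this
      have h5 : (A + 1 + 1) * ‖l - l'‖ ≤ (A + 1 + 1) * d := by gcongr
      linarith
    have h1 : ‖(v (Y t, (1 - t) • l) - v (Y' t, (1 - t) • l')) l‖ ≤ ε / 2 * d := by
      calc _ ≤ K * (‖Y t - Y' t‖ + ‖l - l'‖) * ‖l‖ :=
            (ContinuousLinearMap.le_opNorm _ _).trans
              (mul_le_mul_of_nonneg_right (norm_field_sub_le hv _ _ _ _ ht) (norm_nonneg l))
        _ ≤ K * (2 * (A + 3) * d + d) * ‖l‖ := by gcongr
        _ = K * (2 * (A + 3) + 1) * ‖l‖ * d := by ring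
        _ ≤ ε / 2 * d := by gcongr
    have h2 : ‖(v (Y' t, (1 - t) • l') - v 0) (l - l')‖ ≤ ε / 2 * d := by
      refine (ContinuousLinearMap.le_opNorm _ _).trans ?_
      gcongr
      exact (norm_field_sub_zero_le hv _ _ ht).trans ((hY' t ht).le.trans (min_le_right _ _))
    linarith

end Flow

/-! ### Strict derivatives and germs of homeomorphisms -/

section Inverse

variable {E F : Type*} [NormedAddCommGroup E] [NormedSpace ℝ E]
  [NormedAddCommGroup F] [NormedSpace ℝ F]

/-- A strict derivative at a point gives a Lipschitz bound nearby, and the local inverse is again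
strictly differentiable at the image point. -/
theorem isBiLipschitzGerm_of_hasStrictFDerivAt [CompleteSpace E] {h : E → E} {h' : E ≃L[ℝ] E}
    (h0 : h 0 = 0) (hh : HasStrictFDerivAt h (h' : E →L[ℝ] E) 0) : IsBiLipschitzGerm h := by
  set e := hh.toOpenPartialHomeomorph h
  have he : ∀ x, e x = h x := fun x => rfl
  have hs : (0 : E) ∈ e.source := hh.mem_toOpenPartialHomeomorph_source
  have h1 : HasStrictFDerivAt e.symm (h'.symm : E →L[ℝ] E) (e 0) := hh.to_localInverse
  obtain ⟨K, A, hA, hK⟩ := hh.exists_lipschitzOnWith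
  obtain ⟨K', B, hB, hK'⟩ := h1.exists_lipschitzOnWith
  have hN : A ∩ e ⁻¹' B ∈ 𝓝 (0 : E) := inter_mem hA ((e.continuousAt hs).preimage_mem_nhds hB)
  obtain ⟨V, hV, hVo, h0V⟩ := mem_nhds_iff.1 hN
  refine ⟨h0, e.restrOpen V hVo, ⟨hs, h0V⟩, fun x _ => rfl, ⟨K, hK.mono fun x hx => ?_⟩,
    K', hK'.mono fun y hy => ?_⟩
  · exact (hV hx.2).1
  · have : e (e.symm y) ∈ B := (hV hy.2).2
    rwa [e.right_inv hy.1] at this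

theorem IsDiffeoGerm.exists_hasStrictFDerivAt [FiniteDimensional ℝ E] {h : E → E}
    (hh : IsDiffeoGerm h) :
    ∃ h' : E ≃L[ℝ] E, HasStrictFDerivAt h (h' : E →L[ℝ] E) 0 := by
  obtain ⟨h0, e, hs, he, hc, hc'⟩ := hh
  have he0 : e 0 = 0 := (he 0 hs).trans h0
  have ht : (0 : E) ∈ e.target := by simpa [he0] using e.map_source hs
  have hes : e.symm 0 = 0 := by simpa [he0] using e.left_inv hs
  have h1 : HasStrictFDerivAt e (fderiv ℝ e 0) 0 :=
    (hc.contDiffAt (e.open_source.mem_nhds hs)).hasStrictFDerivAt (by simp)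
  have h2 : HasStrictFDerivAt e.symm (fderiv ℝ e.symm 0) (e 0) := by
    rw [he0]
    exact (hc'.contDiffAt (e.open_target.mem_nhds ht)).hasStrictFDerivAt (by simp)
  have h3 : (fderiv ℝ e.symm 0).comp (fderiv ℝ e 0) = ContinuousLinearMap.id ℝ E := by
    refine (h2.comp 0 h1).hasFDerivAt.unique ((hasFDerivAt_id (0 : E)).congr_of_eventuallyEq ?_)
    filter_upwards [e.open_source.mem_nhds hs] with x hx using e.left_inv hx
  have hinj : Function.Injective (fderiv ℝ e 0 : E →ₗ[ℝ] E) :=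
    Function.LeftInverse.injective (g := fderiv ℝ e.symm 0) fun x => congr($h3 x)
  refine ⟨(LinearEquiv.ofInjectiveEndo _ hinj).toContinuousLinearEquiv, ?_⟩
  refine HasStrictFDerivAt.congr_fderiv (f' := fderiv ℝ e 0) (h1.congr_of_eventuallyEq ?_) rfl
  filter_upwards [e.open_source.mem_nhds hs] with x hx using he x hx

end Inverse
-- The matrix action and its derivative
section Action

variable {n p : ℕ}

theorem act_inv_act (A : Matrix.GeneralLinearGroup (Fin p) ℝ) (y : R p) :
    act A⁻¹ (act A y) = y := by
  simp [act, Matrix.mulVec_mulVec]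

/-- The action of an invertible matrix as a linear automorphism. -/
noncomputable def actEquiv (A : Matrix.GeneralLinearGroup (Fin p) ℝ) : R p ≃L[ℝ] R p :=
  LinearEquiv.toContinuousLinearEquiv
    { toFun := act A
      invFun := act A⁻¹
      map_add' := fun y z => by simp [act, Matrix.mulVec_add]
      map_smul' := fun c y => by simp [act, Matrix.mulVec_smul]
      left_inv := act_inv_act A
      right_inv := fun y => by simpa using act_inv_act A⁻¹ y }

@[simp] theorem actEquiv_apply (A : Matrix.GeneralLinearGroup (Fin p) ℝ) (y : R p) :
    actEquiv A y = act A y := rfl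

@[simp] theorem act_zero (A : Matrix.GeneralLinearGroup (Fin p) ℝ) : act A (0 : R p) = 0 :=
  map_zero (actEquiv A)

/-- By the product rule; the term with the derivative of `M` disappears because it is multiplied by
the vector component, which is `0` at the origin. -/
theorem hasFDerivAt_act {M : R n → Matrix.GeneralLinearGroup (Fin p) ℝ}
    (hM : ∀ a b : Fin p, SmoothNearZero (fun x => (M x).val a b)) :
    HasFDerivAt (fun z : RR n p => act (M z.fst) z.snd)
      ((actEquiv (M 0) : R p →L[ℝ] R p).comp (WithLp.sndL 2 ℝ (R n) (R p))) 0 := by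
  rw [← hasFDerivWithinAt_univ, hasFDerivWithinAt_euclidean]
  intro a
  have hm : ∀ b, DifferentiableAt ℝ (fun z : RR n p => (M z.fst).val a b) 0 := fun b => by
    have h1 : DifferentiableAt ℝ (fun x => (M x).val a b) ((0 : RR n p).fst) :=
      (hM a b).self_of_nhds.differentiableAt (by simp)
    exact h1.comp (0 : RR n p) (WithLp.fstL 2 ℝ (R n) (R p)).differentiableAt
  have hl : ∀ b, HasFDerivAt (fun z : RR n p => z.snd b)
      ((EuclideanSpace.proj b).comp (WithLp.sndL 2 ℝ (R n) (R p))) (0 : RR n p) := fun b =>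
    ((EuclideanSpace.proj b : R p →L[ℝ] ℝ).comp
      (WithLp.sndL 2 ℝ (R n) (R p))).hasFDerivAt
  rw [hasFDerivWithinAt_univ]
  have := HasFDerivAt.fun_sum (u := Finset.univ) fun b _ => (hm b).hasFDerivAt.mul (hl b)
  refine (this.congr_fderiv ?_)
  ext z
  simp [act, Matrix.mulVec, dotProduct]

end Action

/-! ### From trivialising fields to radial curves -/

section Field

open scoped NNReal

variable {n p k : ℕ}

/-- The parametrised field `l ↦ ∑ i, l i • ξ i` of the vector fields `ξ i`. -/
noncomputable def radialField {E Z : Type*} [NormedAddCommGroup E] [NormedSpace ℝ E]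
    (ξ : Fin k → Z → E) (z : Z) : R k →L[ℝ] E :=
  ∑ i, (EuclideanSpace.proj i : R k →L[ℝ] ℝ).smulRight (ξ i z)

theorem radialField_apply {E Z : Type*} [NormedAddCommGroup E] [NormedSpace ℝ E]
    (ξ : Fin k → Z → E) (z : Z) (l : R k) : radialField ξ z l = ∑ i, l i • ξ i z := by
  simp [radialField]

theorem exists_lipschitzWith_radialField {E Z : Type*} [NormedAddCommGroup E] [NormedSpace ℝ E]
    [PseudoMetricSpace Z] {ξ : Fin k → Z → E} (h : ∀ i, ∃ K, LipschitzWith K (ξ i)) :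
    ∃ K, LipschitzWith K (radialField ξ) := by
  choose K hK using h
  refine ⟨∑ i, ‖(EuclideanSpace.proj i : R k →L[ℝ] ℝ)‖₊ * K i,
    LipschitzWith.of_dist_le_mul fun z z' => ?_⟩
  rw [dist_eq_norm, radialField, radialField, ← Finset.sum_sub_distrib]
  push_cast
  rw [Finset.sum_mul]
  refine norm_sum_le_of_le _ fun i _ => ?_
  have : (EuclideanSpace.proj i : R k →L[ℝ] ℝ).smulRight (ξ i z)
      - (EuclideanSpace.proj i : R k →L[ℝ] ℝ).smulRight (ξ i z')
      = (EuclideanSpace.proj i : R k →L[ℝ] ℝ).smulRight (ξ i z - ξ i z') := by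
    ext l; simp [smul_sub]
  rw [this, ContinuousLinearMap.norm_smulRight_apply, mul_assoc]
  exact mul_le_mul_of_nonneg_left (by simpa [dist_eq_norm] using (hK i).dist_le_mul z z')
    (norm_nonneg _)

theorem tendsto_pt_zero :
    Tendsto (fun z : R n × R k => pt z.1 z.2) (𝓝 0) (𝓝 (0 : RR n k)) :=
  (WithLp.prodContinuousLinearEquiv 2 ℝ (R n) (R k)).symm.continuous.tendsto' _ _ (map_zero _)

/-- Extending the germ to a globally Lipschitz map lets the flow estimates dispense with domains. -/
theorem IsStratifiedLipschitzField.exists_lipschitz_extension {S : ℕ → Set (RR n k)}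
    {ξ : RR n k → R n} {i : Fin k} (h : IsStratifiedLipschitzField S (addParamField ξ i)) :
    ∃ w : R n × R k → R n, (∃ K, LipschitzWith K w) ∧
      ∀ᶠ z in 𝓝 (0 : R n × R k), w z = ξ (pt z.1 z.2) := by
  obtain ⟨⟨N, hN, K, hK⟩, -⟩ := h
  let e := (WithLp.prodContinuousLinearEquiv 2 ℝ (R n) (R k)).symm
  have h1 := ((WithLp.fstL 2 ℝ (R n) (R k)).lipschitz.comp_lipschitzOnWith hK).comp
    (e.toContinuousLinearMap.lipschitz.lipschitzOnWith (s := e ⁻¹' N)) (mapsTo_preimage e N)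
  obtain ⟨w, hw, hwe⟩ := h1.extend_finite_dimension
  refine ⟨w, ⟨_, hw⟩, ?_⟩
  filter_upwards [tendsto_pt_zero hN] with z hz
  exact (hwe hz).symm

/-- The velocity of a radial curve together with its parameter is a combination of the fields `ξ i +
∂/∂λ_i`, to which the lifting equation applies. -/
theorem pt_neg_sum (a : Fin k → R n) (l : R k) :
    pt (-∑ i, l i • a i) (-l) = -∑ i, l i • pt (a i) (EuclideanSpace.single i (1 : ℝ)) := by
  apply (WithLp.prodContinuousLinearEquiv 2 ℝ (R n) (R k)).injective
  simp only [map_neg, map_sum, map_smul]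
  ext j
  · simp [Prod.fst_sum]
  · simp [Prod.snd_sum, Finset.sum_apply, Pi.single_apply]

theorem hasFDerivAt_withParam {Φ : RR n k → R p} {z : RR n k} {Φ' : RR n k →L[ℝ] R p}
    (h : HasFDerivAt Φ Φ' z) :
    HasFDerivAt (withParam Φ)
      ((WithLp.prodContinuousLinearEquiv 2 ℝ (R p) (R k)).symm.toContinuousLinearMap.comp
        (Φ'.prod (WithLp.sndL 2 ℝ (R n) (R k)))) z :=
  (WithLp.prodContinuousLinearEquiv 2 ℝ (R p) (R k)).symm.toContinuousLinearMap.hasFDerivAt.comp z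
    (h.prodMk (WithLp.sndL 2 ℝ (R n) (R k)).hasFDerivAt)

theorem comp_fderiv_apply_eq {E F G : Type*} [NormedAddCommGroup E] [NormedSpace ℝ E]
    [NormedAddCommGroup F] [NormedSpace ℝ F] [NormedAddCommGroup G] [NormedSpace ℝ G]
    {φ : E → F} {z : E} (L : F →L[ℝ] G) (hφ : DifferentiableAt ℝ φ z) {A : E →L[ℝ] G}
    (h : HasFDerivAt (fun x => L (φ x)) A z) (v : E) : L (fderiv ℝ φ z v) = A v :=
  congr($((L.hasFDerivAt.comp z hφ.hasFDerivAt).unique h) v)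

theorem fst_fderiv_withParam {Φ : RR n k → R p} {z : RR n k} {Φ' : RR n k →L[ℝ] R p}
    (h : HasFDerivAt Φ Φ' z) (v : RR n k) : (fderiv ℝ (withParam Φ) z v).fst = Φ' v :=
  comp_fderiv_apply_eq (φ := withParam Φ) (WithLp.fstL 2 ℝ (R p) (R k))
    (hasFDerivAt_withParam h).differentiableAt h v

/-- A lift of the parametrised field `u` by `w` over `Φ` takes its integral curves to those of
`u`. -/
theorem eventually_isRadialCurve_comp {Φ : RR n k → R p} (hΦ : IsSmoothMapGerm Φ)
    {ξ : Fin k → RR n k → R n} {η : Fin k → RR p k → R p}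
    (hξη : ∀ i, ∀ᶠ z in 𝓝 (0 : RR n k), fderiv ℝ (withParam Φ) z (addParamField (ξ i) i z) =
      addParamField (η i) i (withParam Φ z))
    {w : Fin k → R n × R k → R n} {u : Fin k → R p × R k → R p}
    (hw : ∀ i, ∀ᶠ z in 𝓝 (0 : R n × R k), w i z = ξ i (pt z.1 z.2))
    (hu : ∀ i, ∀ᶠ z in 𝓝 (0 : R p × R k), u i z = η i (pt z.1 z.2))
    {K : ℝ≥0} (hK : LipschitzWith K (radialField w)) :
    ∀ᶠ z in 𝓝 (0 : R n × R k), ∀ X : ℝ → R n, X 0 = z.1 →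
      IsRadialCurve (radialField w) z.2 X →
      IsRadialCurve (radialField u) z.2 (fun t => Φ (pt (X t) ((1 - t) • z.2))) := by
  have hc : Tendsto (fun z : R n × R k => (Φ (pt z.1 z.2), z.2)) (𝓝 0) (𝓝 (0 : R p × R k)) := by
    refine Tendsto.prodMk_nhds ?_ (continuous_snd.tendsto' _ _ rfl)
    have := hΦ.2.self_of_nhds.continuousAt.tendsto
    rw [hΦ.1] at this
    exact this.comp tendsto_pt_zero
  have hQ : ∀ᶠ z in 𝓝 (0 : R n × R k), DifferentiableAt ℝ Φ (pt z.1 z.2) ∧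
      ∀ i, fderiv ℝ (withParam Φ) (pt z.1 z.2) (pt (w i z) (EuclideanSpace.single i (1 : ℝ))) =
        pt (u i (Φ (pt z.1 z.2), z.2)) (EuclideanSpace.single i (1 : ℝ)) := by
    refine Eventually.and ?_ (eventually_all.2 fun i => ?_)
    · exact (tendsto_pt_zero.eventually hΦ.2).mono fun z hz => hz.differentiableAt (by simp)
    · filter_upwards [tendsto_pt_zero.eventually (hξη i), hw i, hc.eventually (hu i)]
        with z h1 h2 h3
      rw [h2, h3]
      exact h1
  filter_upwards [eventually_forall_isRadialCurve hK hQ] with z hz X hX0 hX t ht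
  obtain ⟨hd, hi⟩ := hz X hX0 hX t ht
  have hl : HasDerivWithinAt (fun t : ℝ => (1 - t) • z.2) (-z.2) (Icc 0 1) t := by
    simpa using ((hasDerivWithinAt_id t (Icc (0 : ℝ) 1)).const_sub 1).smul_const z.2
  have h1 := (WithLp.prodContinuousLinearEquiv 2 ℝ (R n) (R k)).symm.toContinuousLinearMap
    |>.hasFDerivAt.comp_hasDerivWithinAt t ((hX t ht).prodMk hl)
  have h2 := (hasFDerivAt_withParam hd.hasFDerivAt).differentiableAt.hasFDerivAt
    |>.comp_hasDerivWithinAt t h1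
  have h3 := (WithLp.fstL 2 ℝ (R p) (R k)).hasFDerivAt.comp_hasDerivWithinAt t h2
  refine h3.congr_deriv ?_
  change WithLp.fstL 2 ℝ (R p) (R k) (fderiv ℝ (withParam Φ) (pt (X t) ((1 - t) • z.2))
    (pt (-(radialField w (X t, (1 - t) • z.2)) z.2) (-z.2))) = _
  rw [radialField_apply, pt_neg_sum]
  simp only [map_neg, map_sum, map_smul, hi, radialField_apply]
  rfl

theorem hasFDerivAt_sub_act {f : R n → R p} (hf : IsSmoothMapGerm f) (hf0 : HasRankZero f)
    {M : R n → Matrix.GeneralLinearGroup (Fin p) ℝ}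
    (hM : ∀ a b : Fin p, SmoothNearZero (fun x => (M x).val a b)) :
    HasFDerivAt (fun z : RR n p => f z.fst - act (M z.fst) z.snd)
      (-(actEquiv (M 0) : R p →L[ℝ] R p).comp (WithLp.sndL 2 ℝ (R n) (R p))) 0 := by
  have h1 : HasFDerivAt f (0 : R n →L[ℝ] R p) (WithLp.fstL 2 ℝ (R n) (R p) 0) := by
    rw [map_zero]
    exact (hf.2.self_of_nhds.differentiableAt (by simp)).hasFDerivAt.congr_fderiv hf0
  have h2 : HasFDerivAt (fun z : RR n p => f z.fst) (0 : RR n p →L[ℝ] R p) 0 := by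
    have h3 := HasFDerivAt.comp (0 : RR n p) h1 (WithLp.fstL 2 ℝ (R n) (R p)).hasFDerivAt
    rw [ContinuousLinearMap.zero_comp] at h3
    exact h3
  have h3 := h2.fun_sub (hasFDerivAt_act hM)
  rwa [zero_sub] at h3

theorem eq_zero_of_isRadialCurve_zero {E P : Type*} [NormedAddCommGroup E] [NormedSpace ℝ E]
    [NormedAddCommGroup P] [NormedSpace ℝ P] {v : E × P → P →L[ℝ] E} {K : ℝ≥0}
    (hv : LipschitzWith K v) {X : ℝ → E} (h0 : X 0 = 0) (hX : IsRadialCurve v 0 X) : X 1 = 0 := by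
  have := hX.norm_le hv (by simp) (right_mem_Icc.2 zero_le_one)
  rw [h0, norm_zero, norm_zero, mul_zero, add_zero, mul_zero] at this
  exact norm_le_zero_iff.1 this

end Field

end LipGerm

/-! ### The bi-Lipschitz equivalence -/

theorem theorem2 (n p : ℕ)
    (f g : LipGerm.R n → LipGerm.R p)
    (hf : LipGerm.IsSmoothMapGerm f) (hg : LipGerm.IsSmoothMapGerm g)
    (hf0 : LipGerm.HasRankZero f) (hg0 : LipGerm.HasRankZero g)
    (s : LipGerm.R n → LipGerm.R n) (hs : LipGerm.IsDiffeoGerm s)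
    (M : LipGerm.R n → Matrix.GeneralLinearGroup (Fin p) ℝ)
    (hM : ∀ a b : Fin p, LipGerm.SmoothNearZero (fun x => (M x).val a b))
    (hfg : ∀ᶠ x in 𝓝 (0 : LipGerm.R n), f x = LipGerm.act (M x) (g (s x)))
    (hF : LipGerm.IsLipschitzTrivialDeformation f
      (fun z : LipGerm.RR n p => f z.fst - LipGerm.act (M z.fst) z.snd)) :
    LipGerm.BiLipschitzAEquiv f g := by
  open LipGerm in
  obtain ⟨⟨hΦ, -⟩, U, V, S, T, -, -, -, -, -, -, -, -, -, ξ, η, hfields⟩ := hF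
  set Φ : RR n p → R p := fun z => f z.fst - act (M z.fst) z.snd with hΦdef
  choose hξ hη hξη using hfields
  choose w hwL hw using fun i => (hξ i).exists_lipschitz_extension
  choose u huL hu using fun i => (hη i).exists_lipschitz_extension
  obtain ⟨K, hK⟩ := exists_lipschitzWith_radialField hwL
  obtain ⟨K', hK'⟩ := exists_lipschitzWith_radialField huL
  obtain ⟨X, hX⟩ := (exists_isRadialCurve hK).choice
  obtain ⟨Y, hY⟩ := (exists_isRadialCurve hK').choice
  obtain ⟨s', hs'⟩ := hs.exists_hasStrictFDerivAt
  have hs0 : s 0 = 0 := hs.1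
  have hgs : HasStrictFDerivAt (fun x => g (s x)) (0 : R n →L[ℝ] R p) 0 := by
    have h1 : HasStrictFDerivAt g (0 : R n →L[ℝ] R p) (s 0) := by
      rw [hs0]
      exact (hg.2.self_of_nhds.hasStrictFDerivAt (by simp)).congr_fderiv hg0
    simpa using h1.comp 0 hs'
  have hgs0 : g (s 0) = 0 := by rw [hs0, hg.1]
  have hgraph : HasStrictFDerivAt (fun x => (x, g (s x)))
      ((ContinuousLinearMap.id ℝ (R n)).prod (0 : R n →L[ℝ] R p)) 0 :=
    (hasStrictFDerivAt_id 0).prodMk hgs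
  have hgraph_tendsto : Tendsto (fun x => (x, g (s x))) (𝓝 (0 : R n)) (𝓝 (0 : R n × R p)) := by
    have := hgraph.continuousAt.tendsto
    rwa [hgs0] at this
  have hpair_tendsto : Tendsto (fun x => ((0 : R p), g (s x))) (𝓝 (0 : R n))
      (𝓝 (0 : R p × R p)) :=
    Tendsto.prodMk_nhds tendsto_const_nhds ((continuous_snd.tendsto _).comp hgraph_tendsto)
  set ρ : R n → R n := fun x => X (x, g (s x)) 1
  set θ : R p → R p := fun l => Y (0, l) 1
  have hρ0 : ρ 0 = 0 := by
    have h := hX.self_of_nhds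
    simp only [ρ, hgs0]
    exact eq_zero_of_isRadialCurve_zero hK h.1 h.2
  have hθ0 : θ 0 = 0 :=
    eq_zero_of_isRadialCurve_zero hK' hY.self_of_nhds.1 hY.self_of_nhds.2
  have hρ : HasStrictFDerivAt ρ (ContinuousLinearEquiv.refl ℝ (R n) : R n →L[ℝ] R n) 0 := by
    have h1 := hasStrictFDerivAt_of_isRadialCurve hK hX
    rw [show (0 : R n × R p) = (0, g (s 0)) by rw [hgs0]; rfl] at h1
    refine (h1.comp (0 : R n) hgraph).congr_fderiv ?_
    ext x : 1
    simp
  -- At the origin the differential of `Φ` ignores `ξ i`, so the lifting equation determines `η i`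
  -- there.
  have hη0 : ∀ i, u i 0 = -act (M 0) (EuclideanSpace.single i 1) := by
    intro i
    have h1 : HasFDerivAt Φ (-(actEquiv (M 0) : R p →L[ℝ] R p).comp
        (WithLp.sndL 2 ℝ (R n) (R p))) 0 :=
      hasFDerivAt_sub_act hf hf0 hM
    have h2 := congrArg WithLp.fst (hξη i).self_of_nhds
    rw [fst_fderiv_withParam h1] at h2
    have h3 : withParam Φ 0 = pt 0 0 := congrArg (fun y => pt y 0) hΦ.1
    rw [h3] at h2
    rw [(hu i).self_of_nhds]
    exact h2.symm
  have hθ : HasStrictFDerivAt θ (actEquiv (M 0) : R p →L[ℝ] R p) 0 := by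
    have h1 := hasStrictFDerivAt_of_isRadialCurve hK' hY
    refine (h1.comp (0 : R p) ((hasStrictFDerivAt_const (0 : R p) (0 : R p)).prodMk
      (hasStrictFDerivAt_id (0 : R p)))).congr_fderiv ?_
    ext l : 1
    have hl : l = ∑ i, l i • EuclideanSpace.single i (1 : ℝ) := by
      ext j; simp [Finset.sum_apply, Pi.single_apply]
    conv_rhs => rw [hl]
    simp [radialField_apply, hη0]
  have hcomm : ∀ᶠ x in 𝓝 (0 : R n), f (ρ x) = θ (g (s x)) := by
    filter_upwards [hgraph_tendsto.eventually (eventually_isRadialCurve_comp hΦ hξη hw hu hK),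
      hgraph_tendsto.eventually hX, hpair_tendsto.eventually hY,
      hpair_tendsto.eventually (eventually_mul_norm_snd_lt K'), hfg] with x h1 h2 h3 h4 h5
    -- Two integral curves of the target field over the same segment: the image of the source curve,
    -- and the `Y`-curve from `0`. Both start at `0` because `Φ (x, g (s x)) = 0`; at time one the
    -- parameter is `0`, where `Φ` is `f`.
    have h6 := (h1 _ h2.1 h2.2).eq_of_eq_zero hK' h3.2 h4.le
      (by simp [h2.1, h3.1, hΦdef, h5]) (right_mem_Icc.2 zero_le_one)
    simpa [hΦdef] using h6
  have hρi := hρ.to_localInverse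
  have hρi0 : hρ.localInverse ρ _ _ 0 = 0 := by
    simpa [hρ0] using hρ.localInverse_apply_image
  rw [hρ0] at hρi
  refine ⟨fun x => s (hρ.localInverse ρ _ _ x), θ,
    isBiLipschitzGerm_of_hasStrictFDerivAt
      (h' := (ContinuousLinearEquiv.refl ℝ (R n)).symm.trans s') (by rw [hρi0, hs0]) ?_,
    isBiLipschitzGerm_of_hasStrictFDerivAt hθ0 hθ, ?_⟩
  · rw [← hρi0] at hs'
    exact hs'.comp (0 : R n) hρi
  · have h1 : Tendsto (hρ.localInverse ρ _ _) (𝓝 0) (𝓝 0) := by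
      simpa [hρi0] using hρi.continuousAt.tendsto
    have h2 := hρ.eventually_right_inverse
    rw [hρ0] at h2
    filter_upwards [h2, h1.eventually hcomm] with x hx hx'
    rw [← hx', hx]
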